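/- Let $H=(H_{m,n})_{m,n\in\mathbb{N}}$ be an infinite complex matrix (not necessarily Hermitian) that is banded, i.e. for some positive integer $B$ one has $H_{m,n}=0$ whenever $|m-n|>B$, and eventually periodic, i.e. for some period $p\ge 1$ and some $M_+\ge 0$ one has $H_{m,n}=H_{m+p,n+p}$ for all $m\ge M_+$ and all $n$. Such a matrix defines a bounded operator on $\ell^2(\mathbb{N})$, also denoted $H$; let $z\in\mathbb{C}\setminus\sigma(H)$. Let $N_d\ge 0$ be such that the rows of the matrix $z-H$ after the first $N_d$ rows form a matrix $(z-H)_{\mathrm{per}}$ consisting of one block $P\in\mathbb{C}^{p\times w}$ repeating periodically off to infinity: for some $c\ge 0$ and every $k\ge 0$, rows $kp+1,\dots,kp+p$ of $(z-H)_{\mathrm{per}}$ contain $P$ in columns $c+kp+1,\dots,c+kp+w$ and zeros elsewhere. Let $N_b\ge 0$ and let $N_R=kp$ be a positive integer multiple of $p$. Let $R,S\in\mathbb{C}^{N_R\times N_R}$ be the submatrices of $(z-H)_{\mathrm{per}}$ in its first $N_R$ rows and, respectively, columns $N_b+1,\dots,N_b+N_R$ and columns $N_b+N_R+1,\dots,N_b+2N_R$,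 and assume that $R$ and $S$ together contain all the nonzero entries of $(z-H)_{\mathrm{per}}$ in its first $N_R$ rows. Then the matrix pencil $R+\lambda S$ is regular, i.e. $\lambda\mapsto\det(R+\lambda S)$ is not identically zero on $\mathbb{C}$. -/

import Mathlib

namespace EdgePencil

/-- The Hilbert space of square-summable complex sequences (sequences are indexed from `0`). -/
abbrev Ell2 : Type := lp (fun _ : ℕ => ℂ) 2

/-- The infinite matrix `H` is banded. -/
def IsBanded (H : Matrix ℕ ℕ ℂ) : Prop :=
  ∃ B : ℕ, 0 < B ∧ ∀ m n : ℕ, (B : ℤ) < |(m : ℤ) - (n : ℤ)| → H m n = 0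

/-- The infinite matrix `H` is eventually periodic with (positive) period `p`. -/
def IsEventuallyPeriodic (H : Matrix ℕ ℕ ℂ) (p : ℕ) : Prop :=
  0 < p ∧ ∃ M : ℕ, ∀ m : ℕ, M ≤ m → ∀ n : ℕ, H m n = H (m + p) (n + p)

theorem exists_entry_bound {H : Matrix ℕ ℕ ℂ} {p : ℕ} (hB : IsBanded H)
    (hP : IsEventuallyPeriodic H p) : ∃ C : ℝ, 0 ≤ C ∧ ∀ m n, ‖H m n‖ ≤ C := by
  obtain ⟨B, -, hB⟩ := hB
  obtain ⟨hp, M, hM⟩ := hP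
  set K := M + p + B + 1 with hK
  set C : ℝ := ∑ m ∈ Finset.range K, ∑ n ∈ Finset.range (K + B), ‖H m n‖ with hC
  have hC0 : 0 ≤ C := Finset.sum_nonneg fun _ _ => Finset.sum_nonneg fun _ _ => norm_nonneg _
  refine ⟨C, hC0, fun m => ?_⟩
  induction m using Nat.strong_induction_on with
  | _ m ih =>
    intro n
    by_cases hm : m < K
    · by_cases hn : n < K + B
      · have h1 : ‖H m n‖ ≤ ∑ n ∈ Finset.range (K + B), ‖H m n‖ :=
          Finset.single_le_sum (f := fun n => ‖H m n‖) (fun _ _ => norm_nonneg _)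
            (Finset.mem_range.2 hn)
        have h2 : ∑ n ∈ Finset.range (K + B), ‖H m n‖ ≤ C :=
          Finset.single_le_sum (f := fun m => ∑ n ∈ Finset.range (K + B), ‖H m n‖)
            (fun _ _ => Finset.sum_nonneg fun _ _ => norm_nonneg _) (Finset.mem_range.2 hm)
        exact h1.trans h2
      · have h0 : H m n = 0 := by
          apply hB
          rw [lt_abs]
          omega
        simpa [h0] using hC0
    · by_cases hn : n < p
      · have h0 : H m n = 0 := by
          apply hB
          rw [lt_abs]
          omega
        simpa [h0] using hC0
      · have h1 := hM (m - p) (by omega) (n - p)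
        rw [Nat.sub_add_cancel (by omega), Nat.sub_add_cancel (by omega)] at h1
        rw [← h1]
        exact ih (m - p) (by omega) (n - p)

theorem row_support {H : Matrix ℕ ℕ ℂ} {B : ℕ}
    (hB : ∀ m n : ℕ, (B : ℤ) < |(m : ℤ) - (n : ℤ)| → H m n = 0) (x : ℕ → ℂ) (m : ℕ) :
    ∀ n ∉ Finset.Icc (m - B) (m + B), H m n * x n = 0 := by
  intro n hn
  rw [hB m n, zero_mul]
  rw [Finset.mem_Icc] at hn
  rw [lt_abs]
  omega

/-- The Schur-type estimate behind boundedness of banded eventually periodic matrices. -/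
theorem exists_sum_bound {H : Matrix ℕ ℕ ℂ} {p : ℕ} (hB : IsBanded H)
    (hP : IsEventuallyPeriodic H p) :
    ∃ D : ℝ, 0 ≤ D ∧ ∀ (x : Ell2) (s : Finset ℕ),
      ∑ m ∈ s, ‖∑' n, H m n * x n‖ ^ (2 : ENNReal).toReal
        ≤ (D * ‖x‖) ^ (2 : ENNReal).toReal := by
  obtain ⟨C, hC0, hC⟩ := exists_entry_bound hB hP
  obtain ⟨B, -, hB⟩ := hB
  refine ⟨(2 * B + 1) * C, by positivity, fun x s => ?_⟩
  have hcard : ∀ m : ℕ, ((Finset.Icc (m - B) (m + B)).card : ℝ) ≤ 2 * B + 1 := by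
    intro m
    rw [Nat.card_Icc]
    have : m + B + 1 - (m - B) ≤ 2 * B + 1 := by omega
    exact_mod_cast this
  have hrow : ∀ m, ‖∑' n, H m n * x n‖ ^ 2 ≤
      (2 * B + 1) * C ^ 2 * ∑ n ∈ Finset.Icc (m - B) (m + B), ‖x n‖ ^ 2 := by
    intro m
    rw [tsum_eq_sum (row_support hB x m)]
    have h1 : ‖∑ n ∈ Finset.Icc (m - B) (m + B), H m n * x n‖ ≤
        C * ∑ n ∈ Finset.Icc (m - B) (m + B), ‖x n‖ := by
      rw [Finset.mul_sum]
      refine (norm_sum_le _ _).trans (Finset.sum_le_sum fun n _ => ?_)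
      rw [norm_mul]
      exact mul_le_mul_of_nonneg_right (hC m n) (norm_nonneg _)
    have h2 := sq_sum_le_card_mul_sum_sq (s := Finset.Icc (m - B) (m + B)) (f := fun n => ‖x n‖)
    have h3 : 0 ≤ ∑ n ∈ Finset.Icc (m - B) (m + B), ‖x n‖ ^ 2 :=
      Finset.sum_nonneg fun _ _ => by positivity
    calc ‖∑ n ∈ Finset.Icc (m - B) (m + B), H m n * x n‖ ^ 2
        ≤ (C * ∑ n ∈ Finset.Icc (m - B) (m + B), ‖x n‖) ^ 2 := by gcongr
      _ = C ^ 2 * (∑ n ∈ Finset.Icc (m - B) (m + B), ‖x n‖) ^ 2 := by ring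
      _ ≤ C ^ 2 * ((2 * B + 1) * ∑ n ∈ Finset.Icc (m - B) (m + B), ‖x n‖ ^ 2) := by
          gcongr
          exact h2.trans (mul_le_mul_of_nonneg_right (hcard m) h3)
      _ = _ := by ring
  have hsum : ∑ m ∈ s, ∑ n ∈ Finset.Icc (m - B) (m + B), ‖x n‖ ^ 2 ≤ (2 * B + 1) * ‖x‖ ^ 2 := by
    have hcomm : ∑ m ∈ s, ∑ n ∈ Finset.Icc (m - B) (m + B), ‖x n‖ ^ 2 =
        ∑ n ∈ s.biUnion (fun m => Finset.Icc (m - B) (m + B)),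
          ∑ m ∈ s.filter (fun m => n ∈ Finset.Icc (m - B) (m + B)), ‖x n‖ ^ 2 := by
      apply Finset.sum_comm'
      intro m n
      simp only [Finset.mem_biUnion, Finset.mem_filter]
      exact ⟨fun h => ⟨h, m, h⟩, fun h => h.1⟩
    have hx : ∑ n ∈ s.biUnion (fun m => Finset.Icc (m - B) (m + B)), ‖x n‖ ^ 2 ≤ ‖x‖ ^ 2 := by
      have := lp.sum_rpow_le_norm_rpow (p := 2) (by norm_num) x
        (s.biUnion (fun m => Finset.Icc (m - B) (m + B)))
      simpa using this
    rw [hcomm]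
    refine le_trans ?_ (mul_le_mul_of_nonneg_left hx (by positivity : (0 : ℝ) ≤ 2 * B + 1))
    rw [Finset.mul_sum]
    refine Finset.sum_le_sum fun n _ => ?_
    rw [Finset.sum_const, nsmul_eq_mul]
    refine mul_le_mul_of_nonneg_right (le_trans ?_ (hcard n)) (by positivity)
    refine Nat.cast_le.2 (Finset.card_le_card fun m hm => ?_)
    simp only [Finset.mem_filter, Finset.mem_Icc] at hm ⊢
    omega
  simp only [ENNReal.toReal_ofNat, Real.rpow_ofNat]
  calc ∑ m ∈ s, ‖∑' n, H m n * x n‖ ^ 2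
      ≤ ∑ m ∈ s, (2 * B + 1) * C ^ 2 * ∑ n ∈ Finset.Icc (m - B) (m + B), ‖x n‖ ^ 2 :=
        Finset.sum_le_sum fun m _ => hrow m
    _ = (2 * B + 1) * C ^ 2 * ∑ m ∈ s, ∑ n ∈ Finset.Icc (m - B) (m + B), ‖x n‖ ^ 2 := by
        rw [Finset.mul_sum]
    _ ≤ (2 * B + 1) * C ^ 2 * ((2 * B + 1) * ‖x‖ ^ 2) := by gcongr
    _ = _ := by ring

/-- The bounded operator on `ℓ²` given by a banded eventually periodic matrix:
`(H x) m = ∑ n, H m n * x n`, where each sum has finitely many nonzero terms. -/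
noncomputable def toOperator (H : Matrix ℕ ℕ ℂ) {p : ℕ} (hB : IsBanded H)
    (hP : IsEventuallyPeriodic H p) : Ell2 →L[ℂ] Ell2 :=
  LinearMap.mkContinuousOfExistsBound
    { toFun := fun x => ⟨fun m => ∑' n, H m n * x n, by
        obtain ⟨D, -, hD⟩ := exists_sum_bound hB hP
        exact memℓp_gen' (hD x)⟩
      map_add' := fun x y => by
        obtain ⟨B, -, hB'⟩ := hB
        ext m
        change ∑' n, H m n * (x n + y n) = ∑' n, H m n * x n + ∑' n, H m n * y n
        rw [tsum_eq_sum (row_support hB' x m), tsum_eq_sum (row_support hB' y m),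
          tsum_eq_sum (row_support hB' (fun n => x n + y n) m), ← Finset.sum_add_distrib]
        exact Finset.sum_congr rfl fun n _ => mul_add _ _ _
      map_smul' := fun a x => by
        ext m
        change ∑' n, H m n * (a * x n) = a * ∑' n, H m n * x n
        rw [← tsum_mul_left]
        exact tsum_congr fun n => by ring }
    (by
      obtain ⟨D, hD0, hD⟩ := exists_sum_bound hB hP
      exact ⟨D, fun x => lp.norm_le_of_forall_sum_le (by norm_num) (by positivity) (hD x)⟩)

theorem toOperator_apply (H : Matrix ℕ ℕ ℂ) {p : ℕ} (hB : IsBanded H)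
    (hP : IsEventuallyPeriodic H p) (x : Ell2) (m : ℕ) :
    toOperator H hB hP x m = ∑' n, H m n * x n := rfl

/-- The rows of `z - H` after the first `Nd` rows. -/
def lowerRows (H : Matrix ℕ ℕ ℂ) (z : ℂ) (Nd : ℕ) : Matrix ℕ ℕ ℂ :=
  (z • (1 : Matrix ℕ ℕ ℂ) - H).submatrix (fun i => Nd + i) id

/-- `A` consists of the `p × w` block `P` repeating off to infinity: the `k`-th copy occupies
the rows `k * p, …, k * p + p - 1` and the columns `c + k * p, …, c + k * p + w - 1`, and all
the other entries are zero. -/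
def IsPeriodicRepetition (A : Matrix ℕ ℕ ℂ) {p w : ℕ} (P : Matrix (Fin p) (Fin w) ℂ)
    (c : ℕ) : Prop :=
  ∀ (k : ℕ) (i : Fin p) (n : ℕ),
    A (k * p + i) n =
      if h : c + k * p ≤ n ∧ n - (c + k * p) < w then P i ⟨n - (c + k * p), h.2⟩ else 0

/-- The `q × q` submatrix of `A` in the top `q` rows and the `q` columns starting at `Nb`. -/
def blockR (A : Matrix ℕ ℕ ℂ) (Nb q : ℕ) : Matrix (Fin q) (Fin q) ℂ :=
  Matrix.of fun i j => A i (Nb + j)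

/-- The `q × q` submatrix of `A` immediately to the right of `blockR A Nb q`. -/
def blockS (A : Matrix ℕ ℕ ℂ) (Nb q : ℕ) : Matrix (Fin q) (Fin q) ℂ :=
  Matrix.of fun i j => A i (Nb + q + j)

/-- `blockR A Nb q` and `blockS A Nb q` together contain all the nonzero entries of `A` in the
rows they cover. -/
def BlocksContainRows (A : Matrix ℕ ℕ ℂ) (Nb q : ℕ) : Prop :=
  ∀ i n : ℕ, i < q → A i n ≠ 0 → Nb ≤ n ∧ n < Nb + 2 * q

/-- A square matrix pencil is regular if its determinant is not identically zero. -/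
def IsRegularPencil {q : ℕ} (L : ℂ → Matrix (Fin q) (Fin q) ℂ) : Prop :=
  ∃ μ : ℂ, (L μ).det ≠ 0

end EdgePencil

/-!
If `det (R + μ S)` vanished for every `μ`, then for each `μ` in the open unit disc a null vector `y`
of `R + μ S` would give the square-summable sequence `0, …, 0, y, μ y, μ² y, …`, which all the
periodic rows of `z - H` annihilate. Past the initial zeros, these sequences are eigenvectors of a
shift with distinct eigenvalues `μ`, hence linearly independent. But `z - H` maps each of them into
the finite-dimensional space of sequences supported in the first `Nd` entries, so it would have an
infinite-dimensional kernel.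
-/

namespace EdgePencil

section GeomBlockSeq

variable (N q : ℕ) [NeZero q]

/-- The sequence `0, …, 0, y, μ y, μ² y, …` made of `N` zeros followed by blocks of length `q`:
for a null vector `y` of the pencil at `μ`, a solution of the periodic rows. -/
def geomBlockSeq {R : Type*} [MonoidWithZero R] (μ : R) (y : Fin q → R) (n : ℕ) : R :=
  if n < N then 0 else μ ^ (Nat.divModEquiv q (n - N)).1 * y (Nat.divModEquiv q (n - N)).2

theorem geomBlockSeq_add_mul_add {R : Type*} [MonoidWithZero R] (μ : R) (y : Fin q → R)
    (j : ℕ) (l : Fin q) :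
    geomBlockSeq N q μ y (N + (j * q + l)) = μ ^ j * y l := by
  have hjl : Nat.divModEquiv q (j * q + l) = (j, l) :=
    (Nat.divModEquiv q).apply_symm_apply (j, l)
  rw [geomBlockSeq, if_neg (by omega), Nat.add_sub_cancel_left, hjl]

theorem geomBlockSeq_add_mul {R : Type*} [MonoidWithZero R] (μ : R) (y : Fin q → R) {n : ℕ}
    (hn : N ≤ n) (j : ℕ) :
    geomBlockSeq N q μ y (n + j * q) = μ ^ j * geomBlockSeq N q μ y n := by
  obtain ⟨m, rfl⟩ := Nat.exists_eq_add_of_le hn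
  obtain ⟨⟨i, l⟩, rfl⟩ := (Nat.divModEquiv q).symm.surjective m
  have hshift : N + (i * q + l) + j * q = N + ((j + i) * q + l) := by ring
  simp only [Nat.divModEquiv_symm_apply]
  rw [hshift, geomBlockSeq_add_mul_add, geomBlockSeq_add_mul_add, pow_add, mul_assoc]

theorem summable_norm_geomBlockSeq_rpow {𝕜 : Type*} [NormedDivisionRing 𝕜] {μ : 𝕜}
    (hμ : ‖μ‖ < 1) (y : Fin q → 𝕜) {r : ℝ} (hr : 0 < r) :
    Summable fun n => ‖geomBlockSeq N q μ y n‖ ^ r := by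
  have hgeom : Summable fun j : ℕ => (‖μ‖ ^ r) ^ j :=
    summable_geometric_of_lt_one (by positivity) (Real.rpow_lt_one (norm_nonneg μ) hμ hr)
  have hblock : Summable fun l : Fin q => ‖y l‖ ^ r := (hasSum_fintype _).summable
  rw [← summable_nat_add_iff N, ← (Nat.divModEquiv q).symm.summable_iff]
  refine (hgeom.mul_of_nonneg hblock (fun _ => by positivity) fun _ => by positivity).congr
    fun ⟨j, l⟩ => ?_
  rw [Function.comp_apply, Nat.divModEquiv_symm_apply, add_comm _ N, geomBlockSeq_add_mul_add,
    norm_mul, norm_pow, Real.mul_rpow (by positivity) (by positivity), Real.rpow_pow_comm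
    (norm_nonneg μ)]

theorem memℓp_geomBlockSeq {𝕜 : Type*} [NormedDivisionRing 𝕜] {μ : 𝕜} (hμ : ‖μ‖ < 1)
    (y : Fin q → 𝕜) {p : ENNReal} (hp : p ≠ 0) :
    Memℓp (geomBlockSeq N q μ y) p := by
  have hfinite {r : ENNReal} (hr : r ≠ 0) (hr' : r ≠ ⊤) : Memℓp (geomBlockSeq N q μ y) r :=
    memℓp_gen (summable_norm_geomBlockSeq_rpow N q hμ y (ENNReal.toReal_pos hr hr'))
  obtain rfl | hp' := eq_or_ne p ⊤
  · exact (hfinite one_ne_zero ENNReal.one_ne_top).of_exponent_ge le_top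
  · exact hfinite hp hp'

theorem linearIndependent_geomBlockSeq {R ι : Type*} [CommRing R] [IsDomain R] {μ : ι → R}
    (hμ : Function.Injective μ) {y : ι → Fin q → R} (hy : ∀ i, y i ≠ 0) :
    LinearIndependent R fun i => geomBlockSeq N q (μ i) (y i) := by
  refine LinearIndependent.of_comp (LinearMap.funLeft R R (N + ·)) ?_
  refine Module.End.eigenvectors_linearIndependent' (LinearMap.funLeft R R (· + q)) μ hμ _
    fun i => ⟨Module.End.mem_eigenspace_iff.2 ?_, fun hzero => hy i ?_⟩
  · ext n
    simpa [LinearMap.funLeft_apply, add_assoc] using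
      geomBlockSeq_add_mul N q (μ i) (y i) (Nat.le_add_right N n) 1
  · ext l
    calc y i l = geomBlockSeq N q (μ i) (y i) (N + (0 * q + l)) := by
          rw [geomBlockSeq_add_mul_add, pow_zero, one_mul]
      _ = 0 := congrFun hzero (0 * q + l)

end GeomBlockSeq

/-- Row `i + q` of `A` is row `i` moved `q` columns to the right. Unlike `IsPeriodicRepetition`,
this passes from a period to its multiples without naming the repeated block. -/
structure IsShiftPeriodic {R : Type*} [Zero R] (A : Matrix ℕ ℕ R) (q : ℕ) : Prop where
  apply_add_add : ∀ i n, A (i + q) (n + q) = A i n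
  apply_add_of_lt : ∀ i n, n < q → A (i + q) n = 0

theorem IsPeriodicRepetition.isShiftPeriodic {A : Matrix ℕ ℕ ℂ} {p w c : ℕ}
    {P : Matrix (Fin p) (Fin w) ℂ} (hA : IsPeriodicRepetition A P c) : IsShiftPeriodic A p := by
  obtain rfl | hp := p.eq_zero_or_pos
  · exact ⟨fun _ _ => rfl, fun _ _ hn => absurd hn (Nat.not_lt_zero _)⟩
  have : NeZero p := ⟨hp.ne'⟩
  have exists_eq (i : ℕ) : ∃ (k : ℕ) (r : Fin p), i = k * p + r ∧ i + p = (k + 1) * p + r :=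
    ⟨i / p, Fin.ofNat p i, (Nat.div_add_mod' i p).symm, by
      rw [add_one_mul, add_right_comm, Fin.val_ofNat, Nat.div_add_mod']⟩
  refine ⟨fun i n => ?_, fun i n hn => ?_⟩ <;> obtain ⟨k, r, hi, hip⟩ := exists_eq i
  · have hle : c + (k + 1) * p ≤ n + p ↔ c + k * p ≤ n := by rw [add_one_mul]; omega
    have hsub : n + p - (c + (k + 1) * p) = n - (c + k * p) := by rw [add_one_mul]; omega
    rw [hip, hA, hi, hA]
    simp only [hle, hsub]
  · rw [hip, hA, dif_neg]
    rw [add_one_mul]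
    omega

namespace IsShiftPeriodic

theorem mul {R : Type*} [Zero R] {A : Matrix ℕ ℕ R} {q : ℕ} (hA : IsShiftPeriodic A q) (k : ℕ) :
    IsShiftPeriodic A (k * q) := by
  induction k with
  | zero => exact ⟨by simp, by simp⟩
  | succ k ih =>
    rw [add_one_mul]
    refine ⟨fun i n => ?_, fun i n hn => ?_⟩
    · rw [← add_assoc, ← add_assoc, hA.apply_add_add, ih.apply_add_add]
    · rw [← add_assoc]
      obtain hnq | hqn := lt_or_ge n q
      · exact hA.apply_add_of_lt _ _ hnq
      · obtain ⟨m, rfl⟩ := Nat.exists_eq_add_of_le' hqn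
        rw [hA.apply_add_add, ih.apply_add_of_lt _ _ (by omega)]

theorem tsum_row_add_mul {R : Type*} [NonUnitalNonAssocSemiring R] [TopologicalSpace R]
    {A : Matrix ℕ ℕ R} {q : ℕ} (hA : IsShiftPeriodic A q) (x : ℕ → R) (i : ℕ) :
    ∑' n, A (i + q) n * x n = ∑' n, A i n * x (n + q) := by
  have hsupp : Function.support (fun n => A (i + q) n * x n) ⊆ Set.range (· + q) := by
    intro n hn
    have hqn : q ≤ n := not_lt.1 fun hlt => left_ne_zero_of_mul hn (hA.apply_add_of_lt i n hlt)
    exact ⟨n - q, Nat.sub_add_cancel hqn⟩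
  rw [← (add_left_injective q).tsum_eq hsupp]
  simp only [hA.apply_add_add]

end IsShiftPeriodic

theorem tsum_mul_geomBlockSeq_eq_mulVec {A : Matrix ℕ ℕ ℂ} {N q : ℕ} [NeZero q]
    (hN : BlocksContainRows A N q) (μ : ℂ) (y : Fin q → ℂ) (i : Fin q) :
    ∑' n, A i n * geomBlockSeq N q μ y n =
      (blockR A N q + μ • blockS A N q).mulVec y i := by
  have hsupp : ∀ n ∉ Finset.range (N + (q + q)), A i n * geomBlockSeq N q μ y n = 0 := by
    intro n hn
    refine mul_eq_zero_of_left (not_not.1 fun hne => hn ?_) _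
    have := hN i n i.2 hne
    rw [Finset.mem_range]
    omega
  have hhead : ∑ n ∈ Finset.range N, A i n * geomBlockSeq N q μ y n = 0 :=
    Finset.sum_eq_zero fun n hn => by rw [geomBlockSeq, if_pos (Finset.mem_range.1 hn), mul_zero]
  have hR (l : Fin q) : geomBlockSeq N q μ y (N + l) = y l := by
    simpa using geomBlockSeq_add_mul_add N q μ y 0 l
  have hS (l : Fin q) : geomBlockSeq N q μ y (N + (q + l)) = μ * y l := by
    simpa using geomBlockSeq_add_mul_add N q μ y 1 l
  rw [tsum_eq_sum hsupp, Finset.sum_range_add, hhead, zero_add, Finset.sum_range_add,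
    Finset.sum_range, Finset.sum_range, ← Finset.sum_add_distrib]
  refine Finset.sum_congr rfl fun l _ => ?_
  simp only [hR, hS, Matrix.add_apply, Matrix.smul_apply, smul_eq_mul, blockR, blockS,
    Matrix.of_apply, add_assoc]
  ring

theorem tsum_mul_geomBlockSeq_eq_zero {A : Matrix ℕ ℕ ℂ} {N q : ℕ} [NeZero q]
    (hA : IsShiftPeriodic A q) (hN : BlocksContainRows A N q) {μ : ℂ} {y : Fin q → ℂ}
    (hy : (blockR A N q + μ • blockS A N q).mulVec y = 0) (i : ℕ) :
    ∑' n, A i n * geomBlockSeq N q μ y n = 0 := by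
  obtain ⟨⟨j, l⟩, rfl⟩ := (Nat.divModEquiv q).symm.surjective i
  have hterm (n : ℕ) : A l n * geomBlockSeq N q μ y (n + j * q) =
      μ ^ j * (A l n * geomBlockSeq N q μ y n) := by
    obtain hzero | hne := eq_or_ne (A l n) 0
    · simp [hzero]
    · rw [geomBlockSeq_add_mul N q μ y (hN l n l.2 hne).1, mul_left_comm]
  calc ∑' n, A (j * q + l) n * geomBlockSeq N q μ y n
      = ∑' n, A l n * geomBlockSeq N q μ y (n + j * q) := by
        rw [add_comm, (hA.mul j).tsum_row_add_mul]
    _ = μ ^ j * (blockR A N q + μ • blockS A N q).mulVec y l := by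
        simp only [hterm, tsum_mul_left, tsum_mul_geomBlockSeq_eq_mulVec hN]
    _ = 0 := by rw [hy, Pi.zero_apply, mul_zero]

theorem exists_linearIndependent_of_not_isRegularPencil {A : Matrix ℕ ℕ ℂ} {N q : ℕ}
    (hA : IsShiftPeriodic A q) (hN : BlocksContainRows A N q)
    (hsing : ¬ IsRegularPencil fun μ => blockR A N q + μ • blockS A N q) :
    ∃ v : Metric.ball (0 : ℂ) 1 → Ell2,
      LinearIndependent ℂ v ∧ ∀ μ i, ∑' n, A i n * v μ n = 0 := by
  simp only [IsRegularPencil, not_exists, not_not] at hsing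
  have : NeZero q := ⟨by rintro rfl; simpa using hsing 0⟩
  choose y hy_ne hy using fun μ => Matrix.exists_mulVec_eq_zero_iff.2 (hsing μ)
  let v (μ : Metric.ball (0 : ℂ) 1) : Ell2 :=
    ⟨geomBlockSeq N q μ.1 (y μ), memℓp_geomBlockSeq N q (mem_ball_zero_iff.1 μ.2) (y μ) two_ne_zero⟩
  refine ⟨v, LinearIndependent.of_comp (LinearMap.pi (lp.evalₗ (𝕜 := ℂ) _ 2)) ?_,
    fun μ => tsum_mul_geomBlockSeq_eq_zero hA hN (hy μ)⟩
  exact linearIndependent_geomBlockSeq N q Subtype.val_injective fun μ => hy_ne μ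

theorem finiteDimensional_ker_pi_evalₗ {𝕜 α κ : Type*} [NormedField 𝕜] {E : α → Type*}
    [∀ a, NormedAddCommGroup (E a)] [∀ a, NormedSpace 𝕜 (E a)] [∀ a, FiniteDimensional 𝕜 (E a)]
    (p : ENNReal) {f : κ → α} (hf : (Set.range f)ᶜ.Finite) :
    FiniteDimensional 𝕜 (LinearMap.pi fun k => lp.evalₗ (𝕜 := 𝕜) E p (f k)).ker := by
  have := hf.to_subtype
  let restrict := LinearMap.pi fun a : ↥(Set.range f)ᶜ => lp.evalₗ (𝕜 := 𝕜) E p a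
  refine FiniteDimensional.of_injective (restrict ∘ₗ Submodule.subtype _)
    ((injective_iff_map_eq_zero _).2 fun x hx => ?_)
  ext a
  by_cases ha : a ∈ Set.range f
  · obtain ⟨k, rfl⟩ := ha
    exact congrFun (LinearMap.mem_ker.1 x.2) k
  · exact congrFun hx ⟨a, ha⟩

theorem eigenspace_eq_bot_of_notMem_spectrum {R E : Type*} [CommRing R] [AddCommGroup E]
    [Module R E] [TopologicalSpace E] [IsTopologicalAddGroup E] [ContinuousConstSMul R E]
    {T : E →L[R] E} {z : R} (hz : z ∉ spectrum R T) :
    Module.End.eigenspace (T : E →ₗ[R] E) z = ⊥ := by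
  by_contra heigen
  exact Module.End.HasEigenvalue.mem_spectrum heigen
    ((spectrum.notMem_iff.1 hz).map ContinuousLinearMap.toLinearMapRingHom)

theorem tsum_lowerRows_mul (H : Matrix ℕ ℕ ℂ) {p : ℕ} (hB : IsBanded H)
    (hP : IsEventuallyPeriodic H p) (z : ℂ) (Nd : ℕ) (x : Ell2) (i : ℕ) :
    ∑' n, lowerRows H z Nd i n * x n = z * x (Nd + i) - toOperator H hB hP x (Nd + i) := by
  have hdiag : HasSum (fun n => (z • (1 : Matrix ℕ ℕ ℂ)) (Nd + i) n * x n) (z * x (Nd + i)) := by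
    convert hasSum_single (Nd + i) fun n hn => ?_ using 1
    · simp
    · simp [Matrix.one_apply_ne hn.symm]
  have hH : Summable fun n => H (Nd + i) n * x n := by
    obtain ⟨B, -, hB⟩ := hB
    exact summable_of_ne_finset_zero (row_support hB x (Nd + i))
  rw [toOperator_apply, ← (hdiag.sub hH.hasSum).tsum_eq]
  simp only [lowerRows, Matrix.submatrix_apply, Matrix.sub_apply, id_eq, sub_mul]

end EdgePencil

open EdgePencil in
theorem mainTheorem5_general {H : Matrix ℕ ℕ ℂ} {p : ℕ} (hB : IsBanded H)
    (hP : IsEventuallyPeriodic H p) {z : ℂ}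
    (hz : FiniteDimensional ℂ
      (Module.End.eigenspace (toOperator H hB hP : Ell2 →ₗ[ℂ] Ell2) z))
    {Nd w c : ℕ} {P : Matrix (Fin p) (Fin w) ℂ}
    (hper : IsPeriodicRepetition (lowerRows H z Nd) P c) {Nb k : ℕ}
    (hRS : BlocksContainRows (lowerRows H z Nd) Nb (k * p)) :
    IsRegularPencil fun μ =>
      blockR (lowerRows H z Nd) Nb (k * p) + μ • blockS (lowerRows H z Nd) Nb (k * p) := by
  by_contra hsing
  obtain ⟨v, hv, hAv⟩ :=
    exists_linearIndependent_of_not_isRegularPencil (hper.isShiftPeriodic.mul k) hRS hsing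
  let tail : Ell2 →ₗ[ℂ] ℕ → ℂ := LinearMap.pi fun n => lp.evalₗ _ 2 (Nd + n)
  have htail : FiniteDimensional ℂ tail.ker :=
    finiteDimensional_ker_pi_evalₗ 2 <| (Set.finite_lt_nat Nd).subset fun n hn =>
      not_le.1 fun hle => hn ⟨n - Nd, Nat.add_sub_of_le hle⟩
  let T : Module.End ℂ Ell2 := (toOperator H hB hP : Ell2 →ₗ[ℂ] Ell2) - z • 1
  have hker : FiniteDimensional ℂ T.ker := by rwa [← Module.End.eigenspace_def]
  let W : Submodule ℂ Ell2 := tail.ker.comap T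
  have hW : FiniteDimensional ℂ W := inferInstance
  have hvW (μ) : v μ ∈ W := by
    ext n
    have h := (tsum_lowerRows_mul H hB hP z Nd (v μ) n).symm.trans (hAv μ n)
    exact sub_eq_zero.2 (sub_eq_zero.1 h).symm
  have : Infinite (Metric.ball (0 : ℂ) 1) :=
    (infinite_of_mem_nhds 0 (Metric.ball_mem_nhds 0 one_pos)).to_subtype
  exact Module.Finite.not_linearIndependent_of_infinite (fun μ => (⟨v μ, hvW μ⟩ : W))
    (LinearIndependent.of_comp W.subtype hv)

theorem mainTheorem5 (H : Matrix ℕ ℕ ℂ) (p : ℕ)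
    (hB : EdgePencil.IsBanded H) (hP : EdgePencil.IsEventuallyPeriodic H p)
    (z : ℂ) (hz : z ∉ spectrum ℂ (EdgePencil.toOperator H hB hP))
    (Nd w c : ℕ) (P : Matrix (Fin p) (Fin w) ℂ)
    (hper : EdgePencil.IsPeriodicRepetition (EdgePencil.lowerRows H z Nd) P c)
    (Nb k : ℕ) (hk : 0 < k)
    (hRS : EdgePencil.BlocksContainRows (EdgePencil.lowerRows H z Nd) Nb (k * p)) :
    EdgePencil.IsRegularPencil (fun μ : ℂ =>
      EdgePencil.blockR (EdgePencil.lowerRows H z Nd) Nb (k * p) +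
        μ • EdgePencil.blockS (EdgePencil.lowerRows H z Nd) Nb (k * p)) := by
  have hbot := EdgePencil.eigenspace_eq_bot_of_notMem_spectrum hz
  exact mainTheorem5_general hB hP (hbot ▸ inferInstance) hper hRS
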